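/- Let $\mathbb{F}$ be a finite field and let $m,n,p,q$ be positive integers. Two matrices $A,B$ of the same size over $\mathbb{F}$ are called adjacent if $\operatorname{rank}(A-B)=1$, and a set of matrices is called adjacent if any two distinct elements of it are adjacent. A map $\phi : M_{m\times n}(\mathbb{F}) \to M_{p\times q}(\mathbb{F})$ preserves adjacency if $\phi(A)$ and $\phi(B)$ are adjacent whenever $A,B\in M_{m\times n}(\mathbb{F})$ are adjacent. An adjacency preserving map $\phi$ is called degenerate if for every $A \in M_{m\times n}(\mathbb{F})$ there exist a nonzero column $x \in M_{p\times 1}(\mathbb{F})$ and a nonzero row $y \in M_{1\times q}(\mathbb{F})$ such that $$\phi\bigl(\{B \in M_{m\times n}(\mathbb{F}) : \operatorname{rank}(A-B)\le 1\}\bigr) \subset \{\phi(A)+vy : v\in M_{p\times 1}(\mathbb{F})\} \cup \{\phi(A)+xu : u\in M_{1\times q}(\mathbb{F})\}.$$ If $\phi : M_{m\times n}(\mathbb{F}) \to M_{p\times q}(\mathbb{F})$ is a degenerate adjacency preserving map, then the range of $\phi$ is an adjacent set; that is, $\operatorname{rank}(\phi(A)-\phi(B))=1$ for all $A,B\in M_{m\times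 n}(\mathbb{F})$ with $\phi(A)\neq\phi(B)$. -/

import Mathlib

namespace MatrixGeometry

variable {F : Type*} [Field F] {m n p q : ℕ}

/-- Two matrices are adjacent if their difference has rank one. -/
def Adjacent (A B : Matrix (Fin m) (Fin n) F) : Prop :=
  (A - B).rank = 1

/-- A set of matrices is adjacent if any two distinct members of it are adjacent. -/
def IsAdjacentSet (S : Set (Matrix (Fin m) (Fin n) F)) : Prop :=
  ∀ A ∈ S, ∀ B ∈ S, A ≠ B → Adjacent A B

/-- `φ` preserves adjacency (in one direction). -/
def PreservesAdjacency (φ : Matrix (Fin m) (Fin n) F → Matrix (Fin p) (Fin q) F) : Prop :=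
  ∀ A B, Adjacent A B → Adjacent (φ A) (φ B)

/-- The ball of radius one around `A` for the arithmetic distance `rank (A - B)`. -/
def unitBall (A : Matrix (Fin m) (Fin n) F) : Set (Matrix (Fin m) (Fin n) F) :=
  {B | (A - B).rank ≤ 1}

/-- The set `R(y)` of all products `v y` (column times row), with the row `y` fixed. -/
def rightSet (p : ℕ) (y : Fin q → F) : Set (Matrix (Fin p) (Fin q) F) :=
  {M | ∃ v : Fin p → F, M = Matrix.vecMulVec v y}

/-- The set `L(x)` of all products `x u` (column times row), with the column `x` fixed. -/
def leftSet (q : ℕ) (x : Fin p → F) : Set (Matrix (Fin p) (Fin q) F) :=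
  {M | ∃ u : Fin q → F, M = Matrix.vecMulVec x u}

/-- `φ` is degenerate with respect to `A`: it maps the unit ball around `A` into
`(φ A + R(y)) ∪ (φ A + L(x))` for some nonzero column `x` and nonzero row `y`. -/
def IsDegenerateAt (φ : Matrix (Fin m) (Fin n) F → Matrix (Fin p) (Fin q) F)
    (A : Matrix (Fin m) (Fin n) F) : Prop :=
  ∃ x : Fin p → F, ∃ y : Fin q → F, x ≠ 0 ∧ y ≠ 0 ∧
    φ '' unitBall A ⊆
      ((fun M => φ A + M) '' rightSet p y) ∪ ((fun M => φ A + M) '' leftSet q x)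

/-- A degenerate adjacency preserver: an adjacency preserving map which is degenerate with
respect to every matrix of its domain. -/
def IsDegenerateAdjacencyPreserver
    (φ : Matrix (Fin m) (Fin n) F → Matrix (Fin p) (Fin q) F) : Prop :=
  PreservesAdjacency φ ∧ ∀ A, IsDegenerateAt φ A

end MatrixGeometry

namespace MatrixGeometry

section

variable {F : Type*} [Field F] {m n p q : ℕ}

/-! If `n = 1`, any two distinct matrices are adjacent. For `n ≥ 2`, degeneracy improves to a
dichotomy: each unit ball maps wholly into `φ A + R(y)` or wholly into `φ A + L(x)`
(`mapsBall_of_isDegenerateAt`). Adjacent centres have the same type (`not_mapsBallToRight_and_left`)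
and, for type `R`, the same `y` up to scalars. Rank one steps connect all matrices, so the whole
range lies in a single `φ A + R(y)`, which is an adjacent set; type `L` is its transpose. Finiteness
enters through `not_lines_to_line`, a counting argument. -/

theorem rank_neg (M : Matrix (Fin m) (Fin n) F) : (-M).rank = M.rank := by
  have h : (-M).mulVecLin = -M.mulVecLin := by
    ext1
    simp
  rw [Matrix.rank, h, LinearMap.range_neg, Matrix.rank]

theorem eq_zero_of_rank_eq_zero {M : Matrix (Fin m) (Fin n) F} (h : M.rank = 0) : M = 0 := by
  rw [Matrix.rank, Submodule.finrank_eq_zero, LinearMap.range_eq_bot] at h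
  exact Matrix.mulVec_injective (by ext1 v; simpa using congrArg (fun f => f v) h)

theorem adjacent_iff {A B : Matrix (Fin m) (Fin n) F} :
    Adjacent A B ↔ A ≠ B ∧ (A - B).rank ≤ 1 := by
  constructor
  · intro h
    refine ⟨?_, h.le⟩
    rintro rfl
    simp [Adjacent] at h
  · rintro ⟨h, h1⟩
    have h0 : (A - B).rank ≠ 0 := fun h0 => h (sub_eq_zero.mp (eq_zero_of_rank_eq_zero h0))
    unfold Adjacent
    omega

theorem Adjacent.symm {A B : Matrix (Fin m) (Fin n) F} (h : Adjacent A B) : Adjacent B A := by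
  unfold Adjacent at *
  rw [← h, ← neg_sub, rank_neg]

theorem exists_eq_vecMulVec {M : Matrix (Fin m) (Fin n) F} (h : M.rank ≤ 1) :
    ∃ a b, M = Matrix.vecMulVec a b := by
  obtain ⟨a, ha⟩ := finrank_le_one_iff.mp h
  choose c hc using fun j : Fin n =>
    ha ⟨M.mulVecLin (Pi.single j 1), LinearMap.mem_range_self _ _⟩
  refine ⟨a, c, ?_⟩
  ext i j
  have := congrFun (congrArg Subtype.val (hc j)) i
  simp [Matrix.mulVec_single] at this
  rw [Matrix.vecMulVec_apply, ← this, mul_comm]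

theorem vecMulVec_ne_zero' {a : Fin m → F} {b : Fin n → F} (ha : a ≠ 0) (hb : b ≠ 0) :
    Matrix.vecMulVec a b ≠ 0 := by
  obtain ⟨i, hi⟩ := Function.ne_iff.mp ha
  obtain ⟨j, hj⟩ := Function.ne_iff.mp hb
  intro h
  have := congrFun (congrFun h i) j
  rw [Matrix.vecMulVec_apply] at this
  exact mul_ne_zero hi hj this

/-- A matrix lying in both `L(x)` and `R(y)` is a multiple of `x y`. -/
theorem exists_smul_of_mem_inter {x v : Fin p → F} {y u : Fin q → F} (hy : y ≠ 0)
    (h : Matrix.vecMulVec v y = Matrix.vecMulVec x u) :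
    ∃ c : F, Matrix.vecMulVec v y = c • Matrix.vecMulVec x y := by
  obtain ⟨j, hj⟩ := Function.ne_iff.mp hy
  refine ⟨u j / y j, ?_⟩
  have hv (i) : v i = u j / y j * x i := by
    have := congrFun (congrFun h i) j
    rw [Matrix.vecMulVec_apply, Matrix.vecMulVec_apply] at this
    change y j ≠ 0 at hj
    field_simp
    linear_combination this
  ext i k
  simp [Matrix.vecMulVec_apply, hv, mul_assoc]

theorem exists_eq_smul_of_mul_eq_mul {x v : Fin p → F} (hx : x ≠ 0)
    (h : ∀ i k, v i * x k = x i * v k) : ∃ c : F, v = c • x := by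
  obtain ⟨k, hk⟩ := Function.ne_iff.mp hx
  change x k ≠ 0 at hk
  refine ⟨v k / x k, ?_⟩
  ext i
  simp only [Pi.smul_apply, smul_eq_mul]
  field_simp
  linear_combination h i k

/-- Each 2×2 minor of `v y - x u` is, up to sign, a minor of the pair `(v, x)` times a minor of the
pair `(y, u)`. Rank at most one kills all these products, so one of the pairs is dependent. -/
theorem exists_smul_or_of_rank_le_one {x v : Fin p → F} {y u : Fin q → F} (hx : x ≠ 0)
    (hy : y ≠ 0) (h : (Matrix.vecMulVec v y - Matrix.vecMulVec x u).rank ≤ 1) :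
    (∃ c : F, v = c • x) ∨ ∃ c : F, u = c • y := by
  obtain ⟨a, b, hab⟩ := exists_eq_vecMulVec h
  have e (i j) : v i * y j - x i * u j = a i * b j := congrFun (congrFun hab i) j
  by_cases hv : ∀ i k, v i * x k = x i * v k
  · exact Or.inl (exists_eq_smul_of_mul_eq_mul hx hv)
  · push Not at hv
    obtain ⟨i, k, hik⟩ := hv
    refine Or.inr (exists_eq_smul_of_mul_eq_mul hy fun j l => ?_)
    refine mul_left_cancel₀ (sub_ne_zero.mpr hik) ?_
    linear_combination (v k * y l - x k * u l) * e i j + a i * b j * e k l -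
      (v k * y j - x k * u j) * e i l - a i * b l * e k j

theorem adjacent_add_vecMulVec {A : Matrix (Fin m) (Fin n) F} {x : Fin m → F} {u u' : Fin n → F}
    (hx : x ≠ 0) (hu : u ≠ u') :
    Adjacent (A + Matrix.vecMulVec x u) (A + Matrix.vecMulVec x u') := by
  have e : A + Matrix.vecMulVec x u - (A + Matrix.vecMulVec x u') =
      Matrix.vecMulVec x (u - u') := by rw [Matrix.vecMulVec_sub]; abel
  refine adjacent_iff.mpr ⟨fun h => ?_, e ▸ Matrix.rank_vecMulVec_le _ _⟩
  exact vecMulVec_ne_zero' hx (sub_ne_zero.mpr hu) (by rw [← e, h, sub_self])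

theorem adjacent_add_vecMulVec' {A : Matrix (Fin m) (Fin n) F} {v v' : Fin m → F}
    {y : Fin n → F} (hy : y ≠ 0) (hv : v ≠ v') :
    Adjacent (A + Matrix.vecMulVec v y) (A + Matrix.vecMulVec v' y) := by
  have e : A + Matrix.vecMulVec v y - (A + Matrix.vecMulVec v' y) =
      Matrix.vecMulVec (v - v') y := by rw [Matrix.sub_vecMulVec]; abel
  refine adjacent_iff.mpr ⟨fun h => ?_, e ▸ Matrix.rank_vecMulVec_le _ _⟩
  exact vecMulVec_ne_zero' (sub_ne_zero.mpr hv) hy (by rw [← e, h, sub_self])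

theorem rank_sub_add_vecMulVec_le (A : Matrix (Fin m) (Fin n) F) (x : Fin m → F)
    (u : Fin n → F) : (A - (A + Matrix.vecMulVec x u)).rank ≤ 1 := by
  rw [sub_add_cancel_left, rank_neg]
  exact Matrix.rank_vecMulVec_le _ _

/-! ### Images of lines and cliques -/

/-- Over a finite field, two different lines through `A` in a common clique cannot both be mapped
into one line through `φ A`. -/
theorem not_lines_to_line [Finite F] {φ : Matrix (Fin m) (Fin n) F → Matrix (Fin p) (Fin q) F}
    (hφ : PreservesAdjacency φ) {A : Matrix (Fin m) (Fin n) F} {T : Matrix (Fin p) (Fin q) F}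
    {x : Fin m → F} {y y' : Fin n → F} (hx : x ≠ 0) (hy' : y' ≠ 0)
    (hyy : ∀ c : F, y ≠ c • y')
    (h : ∀ c : F, ∃ d : F, φ (A + Matrix.vecMulVec x (c • y)) = φ A + d • T)
    (h' : ∀ c : F, ∃ d : F, φ (A + Matrix.vecMulVec x (c • y')) = φ A + d • T) : False := by
  have inj {u u' : Fin n → F}
      (e : φ (A + Matrix.vecMulVec x u) = φ (A + Matrix.vecMulVec x u')) : u = u' := by
    by_contra hne
    exact (adjacent_iff.mp (hφ _ _ (adjacent_add_vecMulVec (A := A) hx hne))).1 e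
  choose g hg using h
  choose g' hg' using h'
  have hinj' : Function.Injective g' := fun c d hcd =>
    smul_left_injective F hy' (inj (by rw [hg', hg', hcd]))
  -- The line in direction `y'` already fills the target line, so the image of `A + x y` is attained
  -- twice on a clique where `φ` is injective.
  obtain ⟨c, hc⟩ := Finite.surjective_of_injective hinj' (g 1)
  exact hyy c (by simpa using inj (u := (1 : F) • y) (u' := c • y') (by rw [hg, hg', hc]))

/-- A clique inside the unit ball is mapped into one of the two maximal cliques. -/
theorem clique_image {φ : Matrix (Fin m) (Fin n) F → Matrix (Fin p) (Fin q) F}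
    (hφ : PreservesAdjacency φ) {A : Matrix (Fin m) (Fin n) F}
    {x : Fin p → F} {y : Fin q → F} (hx : x ≠ 0) (hy : y ≠ 0) {S : Set (Matrix (Fin m) (Fin n) F)}
    (hS : IsAdjacentSet S)
    (h : ∀ B ∈ S, (∃ v, φ B = φ A + Matrix.vecMulVec v y) ∨
      ∃ u, φ B = φ A + Matrix.vecMulVec x u) :
    (∀ B ∈ S, ∃ v, φ B = φ A + Matrix.vecMulVec v y) ∨
      ∀ B ∈ S, ∃ u, φ B = φ A + Matrix.vecMulVec x u := by
  by_contra hcon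
  rw [not_or] at hcon
  obtain ⟨h1, h2⟩ := hcon
  push Not at h1 h2
  obtain ⟨B, hB, hBv⟩ := h1
  obtain ⟨C, hC, hCu⟩ := h2
  obtain ⟨u, hu⟩ := (h B hB).resolve_left (fun ⟨v, hv⟩ => hBv v hv)
  obtain ⟨v, hv⟩ := (h C hC).resolve_right (fun ⟨v, hv⟩ => hCu v hv)
  have hne : C ≠ B := by
    rintro rfl
    exact hBv v hv
  have hadj := (hφ _ _ (hS C hC B hB hne)).le
  rw [hu, hv, add_sub_add_left_eq_sub] at hadj
  rcases exists_smul_or_of_rank_le_one hx hy hadj with ⟨c, rfl⟩ | ⟨c, rfl⟩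
  · exact hCu (c • y) (by rw [hv, Matrix.smul_vecMulVec, Matrix.vecMulVec_smul])
  · exact hBv (c • x) (by rw [hu, Matrix.smul_vecMulVec, Matrix.vecMulVec_smul])

/-! ### Right and left type of a ball -/

/-- The unit ball around `A` is mapped into `φ A + R(y)`. -/
def MapsBallToRight (φ : Matrix (Fin m) (Fin n) F → Matrix (Fin p) (Fin q) F)
    (A : Matrix (Fin m) (Fin n) F) (y : Fin q → F) : Prop :=
  y ≠ 0 ∧ ∀ B, (A - B).rank ≤ 1 → ∃ v, φ B = φ A + Matrix.vecMulVec v y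

/-- The unit ball around `A` is mapped into `φ A + L(x)`. -/
def MapsBallToLeft (φ : Matrix (Fin m) (Fin n) F → Matrix (Fin p) (Fin q) F)
    (A : Matrix (Fin m) (Fin n) F) (x : Fin p → F) : Prop :=
  x ≠ 0 ∧ ∀ B, (A - B).rank ≤ 1 → ∃ u, φ B = φ A + Matrix.vecMulVec x u

/-- If both types occurred among the row cliques, any column clique would cross a row clique of the
opposite type in a line, whose image is confined to `φ A + F x₀ y₀`. By `not_lines_to_line`, no two
distinct column cliques then share a type, but there are at least three of them. -/
theorem mapsBall_of_isDegenerateAt [Finite F]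
    {φ : Matrix (Fin m) (Fin n) F → Matrix (Fin p) (Fin q) F} (hm : 0 < m) (hn : 2 ≤ n)
    (hφ : PreservesAdjacency φ) {A : Matrix (Fin m) (Fin n) F} (hA : IsDegenerateAt φ A) :
    (∃ y, MapsBallToRight φ A y) ∨ ∃ x, MapsBallToLeft φ A x := by
  obtain ⟨x₀, y₀, hx₀, hy₀, h⟩ := hA
  have hball (B) (hB : (A - B).rank ≤ 1) : (∃ v, φ B = φ A + Matrix.vecMulVec v y₀) ∨
      ∃ u, φ B = φ A + Matrix.vecMulVec x₀ u := by
    rcases h ⟨B, hB, rfl⟩ with ⟨_, ⟨v, rfl⟩, e⟩ | ⟨_, ⟨u, rfl⟩, e⟩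
    · exact Or.inl ⟨v, e.symm⟩
    · exact Or.inr ⟨u, e.symm⟩
  have hrow (x : Fin m → F) (hx : x ≠ 0) :
      (∀ u, ∃ v, φ (A + Matrix.vecMulVec x u) = φ A + Matrix.vecMulVec v y₀) ∨
        ∀ u, ∃ w, φ (A + Matrix.vecMulVec x u) = φ A + Matrix.vecMulVec x₀ w := by
    simpa only [Set.forall_mem_range] using clique_image hφ (A := A) hx₀ hy₀
      (S := Set.range fun u => A + Matrix.vecMulVec x u)
      (by rintro _ ⟨u, rfl⟩ _ ⟨u', rfl⟩ hne
          exact adjacent_add_vecMulVec hx (fun e => hne (by rw [e])))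
      (by rintro _ ⟨u, rfl⟩; exact hball _ (rank_sub_add_vecMulVec_le _ _ _))
  have hcol (y : Fin n → F) (hy : y ≠ 0) :
      (∀ u, ∃ v, φ (A + Matrix.vecMulVec u y) = φ A + Matrix.vecMulVec v y₀) ∨
        ∀ u, ∃ w, φ (A + Matrix.vecMulVec u y) = φ A + Matrix.vecMulVec x₀ w := by
    simpa only [Set.forall_mem_range] using clique_image hφ (A := A) hx₀ hy₀
      (S := Set.range fun u => A + Matrix.vecMulVec u y)
      (by rintro _ ⟨u, rfl⟩ _ ⟨u', rfl⟩ hne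
          exact adjacent_add_vecMulVec' hy (fun e => hne (by rw [e])))
      (by rintro _ ⟨u, rfl⟩; exact hball _ (rank_sub_add_vecMulVec_le _ _ _))
  have hline {B : Matrix (Fin m) (Fin n) F} (h1 : ∃ v, φ B = φ A + Matrix.vecMulVec v y₀)
      (h2 : ∃ w, φ B = φ A + Matrix.vecMulVec x₀ w) :
      ∃ d : F, φ B = φ A + d • Matrix.vecMulVec x₀ y₀ := by
    obtain ⟨v, hv⟩ := h1
    obtain ⟨w, hw⟩ := h2
    obtain ⟨d, hd⟩ := exists_smul_of_mem_inter hy₀ (add_left_cancel (hv.symm.trans hw))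
    exact ⟨d, by rw [hv, hd]⟩
  have hmul (x : Fin m → F) (y : Fin n → F) (c : F) :
      Matrix.vecMulVec x (c • y) = Matrix.vecMulVec (c • x) y := by
    rw [Matrix.smul_vecMulVec, Matrix.vecMulVec_smul]
  have hglue {P : Matrix (Fin m) (Fin n) F → Prop}
      (hP : ∀ x : Fin m → F, x ≠ 0 → ∀ u, P (A + Matrix.vecMulVec x u)) (B)
      (hB : (A - B).rank ≤ 1) : P B := by
    rcases eq_or_ne A B with rfl | hne
    · have : Nonempty (Fin m) := ⟨⟨0, hm⟩⟩
      simpa using hP 1 one_ne_zero 0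
    · rw [← neg_sub, rank_neg] at hB
      obtain ⟨a, b, hab⟩ := exists_eq_vecMulVec hB
      rw [← add_sub_cancel A B, hab]
      refine hP a ?_ b
      rintro rfl
      rw [Matrix.zero_vecMulVec, sub_eq_zero] at hab
      exact hne hab.symm
  by_cases hR : ∀ x : Fin m → F, x ≠ 0 →
      ∀ u, ∃ v, φ (A + Matrix.vecMulVec x u) = φ A + Matrix.vecMulVec v y₀
  · exact Or.inl ⟨y₀, hy₀, hglue hR⟩
  by_cases hL : ∀ x : Fin m → F, x ≠ 0 →
      ∀ u, ∃ w, φ (A + Matrix.vecMulVec x u) = φ A + Matrix.vecMulVec x₀ w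
  · exact Or.inr ⟨x₀, hx₀, hglue hL⟩
  exfalso
  rw [not_forall] at hR hL
  obtain ⟨x, hx⟩ := hR
  obtain ⟨x', hx'⟩ := hL
  rw [Classical.not_imp] at hx hx'
  have hxL := (hrow x hx.1).resolve_left hx.2
  have hxR := (hrow x' hx'.1).resolve_right hx'.2
  have hRR (y y' : Fin n → F) (hy' : y' ≠ 0) (hyy : ∀ c : F, y ≠ c • y')
      (h : ∀ u, ∃ v, φ (A + Matrix.vecMulVec u y) = φ A + Matrix.vecMulVec v y₀)
      (h' : ∀ u, ∃ v, φ (A + Matrix.vecMulVec u y') = φ A + Matrix.vecMulVec v y₀) : False :=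
    not_lines_to_line hφ hx.1 hy' hyy
      (fun c => hline (hmul x y c ▸ h _) (hxL _)) (fun c => hline (hmul x y' c ▸ h' _) (hxL _))
  have hLL (y y' : Fin n → F) (hy' : y' ≠ 0) (hyy : ∀ c : F, y ≠ c • y')
      (h : ∀ u, ∃ w, φ (A + Matrix.vecMulVec u y) = φ A + Matrix.vecMulVec x₀ w)
      (h' : ∀ u, ∃ w, φ (A + Matrix.vecMulVec u y') = φ A + Matrix.vecMulVec x₀ w) : False :=
    not_lines_to_line hφ hx'.1 hy' hyy
      (fun c => hline (hxR _) (hmul x' y c ▸ h _)) (fun c => hline (hxR _) (hmul x' y' c ▸ h' _))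
  -- The rows `e`, `f`, `e + f` are pairwise independent over every field, including the one with
  -- two elements; two of the three column cliques share a type.
  let i : Fin n := ⟨0, by omega⟩
  let j : Fin n := ⟨1, by omega⟩
  have hij : i ≠ j := by simp [i, j]
  let e : Fin n → F := Pi.single i 1
  let f : Fin n → F := Pi.single j 1
  have he : e ≠ 0 := by simp [e]
  have hf : f ≠ 0 := by simp [f]
  have hg : e + f ≠ 0 := fun h => by simpa [e, f, hij] using congrFun h i
  have hef (c : F) : e ≠ c • f := fun h => by simpa [e, f, hij] using congrFun h i
  have hge (c : F) : e + f ≠ c • e := fun h => by simpa [e, f, hij.symm] using congrFun h j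
  have hgf (c : F) : e + f ≠ c • f := fun h => by simpa [e, f, hij] using congrFun h i
  rcases hcol e he with h1 | h1 <;> rcases hcol f hf with h2 | h2 <;>
    rcases hcol (e + f) hg with h3 | h3
  · exact hRR _ _ hf hef h1 h2
  · exact hRR _ _ hf hef h1 h2
  · exact hRR _ _ he hge h3 h1
  · exact hLL _ _ hf hgf h3 h2
  · exact hRR _ _ hf hgf h3 h2
  · exact hLL _ _ he hge h3 h1
  · exact hLL _ _ hf hef h1 h2
  · exact hLL _ _ hf hef h1 h2

/-- The row clique through `A` and `B` lies in both balls, and `φ A + R(y) = φ B + R(y)`. Its image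
therefore lies in the line `φ B + F x y`, too small for two independent directions. -/
theorem not_mapsBallToRight_and_left [Finite F]
    {φ : Matrix (Fin m) (Fin n) F → Matrix (Fin p) (Fin q) F} (hn : 2 ≤ n)
    (hφ : PreservesAdjacency φ) {A B : Matrix (Fin m) (Fin n) F} (hAB : Adjacent A B)
    {x : Fin p → F} {y : Fin q → F} (hA : MapsBallToRight φ A y) (hB : MapsBallToLeft φ B x) :
    False := by
  obtain ⟨a, b, hab⟩ := exists_eq_vecMulVec hAB.symm.le
  obtain rfl : B = A + Matrix.vecMulVec a b := by rw [← hab, add_sub_cancel]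
  have ha : a ≠ 0 := by
    rintro rfl
    exact (adjacent_iff.mp hAB).1 (by simp)
  obtain ⟨v₀, hv₀⟩ := hA.2 _ (rank_sub_add_vecMulVec_le A a b)
  have hline (u : Fin n → F) : ∃ d : F, φ (A + Matrix.vecMulVec a b + Matrix.vecMulVec a u) =
      φ (A + Matrix.vecMulVec a b) + d • Matrix.vecMulVec x y := by
    obtain ⟨w, hw⟩ := hB.2 _ (rank_sub_add_vecMulVec_le _ a u)
    obtain ⟨v, hv⟩ := hA.2 _ (rank_sub_add_vecMulVec_le A a (b + u))
    rw [Matrix.vecMulVec_add, ← add_assoc] at hv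
    have e : Matrix.vecMulVec (v - v₀) y = Matrix.vecMulVec x w := by
      rw [Matrix.sub_vecMulVec]
      rw [hv, hv₀, add_assoc] at hw
      rw [add_left_cancel hw, add_sub_cancel_left]
    obtain ⟨d, hd⟩ := exists_smul_of_mem_inter hA.1 e
    exact ⟨d, by rw [hw, ← e, hd]⟩
  let i : Fin n := ⟨0, by omega⟩
  let j : Fin n := ⟨1, by omega⟩
  have hij : i ≠ j := by simp [i, j]
  refine not_lines_to_line hφ (y := Pi.single i 1) (y' := Pi.single j 1) ha (by simp)
    (fun c h => ?_) (fun c => hline _) (fun c => hline _)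
  simpa [hij] using congrFun h i

/-- The nonzero difference of `φ A` and `φ B` lies in both `R(y)` and `R(y')`, which forces `y'` to
be a multiple of `y`. -/
theorem MapsBallToRight.of_adjacent
    {φ : Matrix (Fin m) (Fin n) F → Matrix (Fin p) (Fin q) F}
    (hφ : PreservesAdjacency φ) {A B : Matrix (Fin m) (Fin n) F} (hAB : Adjacent A B)
    {y y' : Fin q → F} (hA : MapsBallToRight φ A y) (hB : MapsBallToRight φ B y') :
    MapsBallToRight φ B y := by
  obtain ⟨v, hv⟩ := hA.2 B hAB.le
  obtain ⟨w, hw⟩ := hB.2 A hAB.symm.le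
  have hne : φ A ≠ φ B := (adjacent_iff.mp (hφ _ _ hAB)).1
  have e : Matrix.vecMulVec w y' = Matrix.vecMulVec (-v) y := by
    rw [Matrix.neg_vecMulVec]
    rw [hv, add_assoc] at hw
    exact (neg_eq_of_add_eq_zero_right (left_eq_add.mp hw)).symm
  have hw0 : w ≠ 0 := by
    rintro rfl
    exact hne (by simpa using hw)
  obtain ⟨i, hi⟩ := Function.ne_iff.mp hw0
  change w i ≠ 0 at hi
  have hy' : y' = (-v i / w i) • y := by
    ext j
    have := congrFun (congrFun e i) j
    simp only [Matrix.vecMulVec_apply, Pi.neg_apply] at this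
    simp only [Pi.smul_apply, smul_eq_mul]
    field_simp
    linear_combination this
  refine ⟨hA.1, fun C hC => ?_⟩
  obtain ⟨u, hu⟩ := hB.2 C hC
  refine ⟨(-v i / w i) • u, ?_⟩
  rw [hu, hy', Matrix.vecMulVec_smul, Matrix.smul_vecMulVec]

/-- Any property which passes to adjacent matrices passes to all matrices. -/
theorem forall_of_adjacent {P : Matrix (Fin m) (Fin n) F → Prop}
    (hP : ∀ A B, Adjacent A B → P A → P B) {A : Matrix (Fin m) (Fin n) F} (hA : P A)
    (B : Matrix (Fin m) (Fin n) F) : P B := by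
  suffices h : ∀ M A, P A → P (A + M) by simpa using h (B - A) A hA
  intro M
  induction M using Matrix.induction_on' with
  | h_zero => simp
  | h_add M N hM hN =>
    intro A hA
    rw [← add_assoc]
    exact hN _ (hM _ hA)
  | h_std_basis i j c =>
    intro A hA
    rcases eq_or_ne c 0 with rfl | hc
    · simpa using hA
    · refine hP _ _ (adjacent_iff.mpr ⟨?_, ?_⟩) hA
      · intro h
        exact hc (by simpa using congrFun (congrFun (left_eq_add.mp h) i) j)
      · have e : Matrix.single i j c = Matrix.vecMulVec (Pi.single i c) (Pi.single j 1) := by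
          ext k l
          simp [Matrix.single_apply, Matrix.vecMulVec_apply, Pi.single_apply, eq_comm, ite_and]
          split_ifs <;> rfl
        rw [e]
        exact rank_sub_add_vecMulVec_le _ _ _

/-! ### From balls to the whole range -/

theorem isAdjacentSet_range_of_mapsBallToRight [Finite F]
    {φ : Matrix (Fin m) (Fin n) F → Matrix (Fin p) (Fin q) F} (hm : 0 < m) (hn : 2 ≤ n)
    (hφ : IsDegenerateAdjacencyPreserver φ) {A : Matrix (Fin m) (Fin n) F} {y : Fin q → F}
    (hA : MapsBallToRight φ A y) : IsAdjacentSet (Set.range φ) := by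
  have h (B) : MapsBallToRight φ B y ∧ ∃ v, φ B = φ A + Matrix.vecMulVec v y := by
    refine forall_of_adjacent
      (P := fun B => MapsBallToRight φ B y ∧ ∃ v, φ B = φ A + Matrix.vecMulVec v y)
      (fun B C hBC hB => ?_) ⟨hA, 0, by simp⟩ B
    obtain ⟨hB, v, hv⟩ := hB
    obtain ⟨w, hw⟩ := hB.2 C hBC.le
    refine ⟨?_, v + w, by rw [hw, hv, Matrix.add_vecMulVec, add_assoc]⟩
    rcases mapsBall_of_isDegenerateAt hm hn hφ.1 (hφ.2 C) with ⟨y', hC⟩ | ⟨x, hC⟩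
    · exact hB.of_adjacent hφ.1 hBC hC
    · exact (not_mapsBallToRight_and_left hn hφ.1 hBC hB hC).elim
  rintro _ ⟨B, rfl⟩ _ ⟨C, rfl⟩ hne
  obtain ⟨v, hv⟩ := (h B).2
  obtain ⟨w, hw⟩ := (h C).2
  rw [hv, hw] at hne ⊢
  exact adjacent_add_vecMulVec' hA.1 (fun e => hne (by rw [e]))

theorem adjacent_transpose {A B : Matrix (Fin m) (Fin n) F} :
    Adjacent A.transpose B.transpose ↔ Adjacent A B := by
  rw [Adjacent, Adjacent, ← Matrix.transpose_sub, Matrix.rank_transpose]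

/-- Only the target is transposed: this swaps `R` and `L` while keeping the domain, hence the
condition `2 ≤ n`. -/
theorem IsDegenerateAdjacencyPreserver.transpose
    {φ : Matrix (Fin m) (Fin n) F → Matrix (Fin p) (Fin q) F}
    (hφ : IsDegenerateAdjacencyPreserver φ) :
    IsDegenerateAdjacencyPreserver fun A => (φ A).transpose := by
  refine ⟨fun A B h => adjacent_transpose.mpr (hφ.1 A B h), fun A => ?_⟩
  obtain ⟨x, y, hx, hy, h⟩ := hφ.2 A
  refine ⟨y, x, hy, hx, ?_⟩
  rintro _ ⟨B, hB, rfl⟩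
  rcases h ⟨B, hB, rfl⟩ with ⟨_, ⟨v, rfl⟩, e⟩ | ⟨_, ⟨u, rfl⟩, e⟩
  · exact Or.inr ⟨_, ⟨v, rfl⟩, by simp [← e, Matrix.transpose_vecMulVec]⟩
  · exact Or.inl ⟨_, ⟨u, rfl⟩, by simp [← e, Matrix.transpose_vecMulVec]⟩

theorem MapsBallToLeft.transpose
    {φ : Matrix (Fin m) (Fin n) F → Matrix (Fin p) (Fin q) F} {A : Matrix (Fin m) (Fin n) F}
    {x : Fin p → F} (h : MapsBallToLeft φ A x) :
    MapsBallToRight (fun A => (φ A).transpose) A x := by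
  refine ⟨h.1, fun B hB => ?_⟩
  obtain ⟨u, hu⟩ := h.2 B hB
  exact ⟨u, by simp [hu, Matrix.transpose_vecMulVec]⟩

end

end MatrixGeometry

theorem theorem1p3 {F : Type*} [Field F] [Finite F] {m n p q : ℕ}
    (hm : 0 < m) (hn : 0 < n) (hp : 0 < p) (hq : 0 < q)
    (φ : Matrix (Fin m) (Fin n) F → Matrix (Fin p) (Fin q) F)
    (hφ : MatrixGeometry.IsDegenerateAdjacencyPreserver φ) :
    MatrixGeometry.IsAdjacentSet (Set.range φ) := by
  open MatrixGeometry in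
  rcases Nat.lt_or_ge n 2 with h | h
  · rintro _ ⟨A, rfl⟩ _ ⟨B, rfl⟩ hne
    refine hφ.1 A B (adjacent_iff.mpr ⟨fun e => hne (by rw [e]), ?_⟩)
    exact (Matrix.rank_le_width _).trans (by omega)
  · rcases mapsBall_of_isDegenerateAt hm h hφ.1 (hφ.2 0) with ⟨y, hy⟩ | ⟨x, hx⟩
    · exact isAdjacentSet_range_of_mapsBallToRight hm h hφ hy
    · have key := isAdjacentSet_range_of_mapsBallToRight hm h hφ.transpose hx.transpose
      rintro _ ⟨A, rfl⟩ _ ⟨B, rfl⟩ hne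
      exact adjacent_transpose.mp
        (key _ ⟨A, rfl⟩ _ ⟨B, rfl⟩ (fun e => hne (Matrix.transpose_injective e)))
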